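/- Let $X$ be a separable complex Hilbert space and let $A$, with domain $D(A)$, be the infinitesimal generator of an exponentially stable strongly continuous semigroup $(T(t))_{t\ge 0}$ on $X$. Let $\mathcal H_\infty^-$ be the algebra of bounded analytic functions on $\{s\in\mathbb C:\operatorname{Re}s<0\}$; such a $g$ has a boundary function $\omega\mapsto g(i\omega)=\lim_{r\uparrow 0}g(r+i\omega)$, defined for almost every $\omega\in\mathbb R$. For $f\in L^2((0,\infty);X)$ put $M_gf=\mathcal L^{-1}\,\Pi\,(g\,\mathcal L f)$, where $\mathcal L$ is the Laplace transform, seen as a map into $L^2(i\mathbb R;X)$, $\mathcal H_2(X)$ is its range, and $\Pi$ is the orthogonal projection of $L^2(i\mathbb R;X)$ onto $\mathcal H_2(X)$. The operator $g(A)$ is the linear map from $D(A)$ to $X$, bounded for the graph norm of $D(A)$, that satisfies $$M_g\big(T(\cdot)x\big)=g(A)\,T(\cdot)x\quad\text{in }L^2((0,\infty);X),\qquad x\in D(A).$$ (i) Suppose that $g\in\mathcal H_\infty^-$ is the Fourier transform of a function $h\in L^1(\mathbb R)$ that vanishes almost everywhere on $[0,\infty)$, that is, $g(i\omega)=\int_{-\infty}^{\infty}h(t)e^{-i\omega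 t}\,dt$ for almost all $\omega\in\mathbb R$. Then $g(A)$ exists, is unique, and extends to a bounded operator on $X$, which is given by the absolutely convergent integral $$g(A)x=\int_0^\infty T(t)\,h(-t)\,x\,dt,\qquad x\in X.$$ Thus $g(A)$ agrees with the operator that the classical (Hille--Phillips) definition assigns to $g$. (ii) For example, let $\operatorname{Re}\alpha>0$ and $g(s)=\dfrac{1}{\alpha-s}$. Then $g\in\mathcal H_\infty^-$, the assumption of (i) holds with $h(t)=e^{\alpha t}$ for $t<0$ and $h(t)=0$ for $t\ge 0$, the operator $\alpha I-A:D(A)\to X$ has a bounded inverse, and $g(A)=(\alpha I-A)^{-1}$. -/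

import Mathlib

open MeasureTheory Filter Topology Set
open scoped ENNReal

noncomputable section

/-! ### The scalar functions -/

/-- `g ∈ H_∞^-`: `g` is bounded and analytic on the open left half-plane.  Values of `g` elsewhere
play no role. -/
def MemHInfMinus (g : ℂ → ℂ) : Prop :=
  DifferentiableOn ℂ g {s : ℂ | s.re < 0} ∧ ∃ c : ℝ, ∀ s : ℂ, s.re < 0 → ‖g s‖ ≤ c

/-- The boundary value at `i ω` of `g`, a function on the open left half-plane, is `z`. -/
def HasBoundaryValue (g : ℂ → ℂ) (ω : ℝ) (z : ℂ) : Prop :=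
  Tendsto (fun r : ℝ => g ((r : ℂ) + (ω : ℂ) * Complex.I)) (𝓝[<] 0) (𝓝 z)

/-- `h ∈ L¹(ℝ)` is supported in `(-∞, 0)`, and `g` (through its boundary function) is the Fourier
transform of `h`, that is, `g(iω) = ∫ h(t) e^{-iωt} dt` for almost all `ω`. -/
structure IsFourierTransformOfL1 (g : ℂ → ℂ) (h : ℝ → ℂ) : Prop where
  integrable : Integrable h
  support : ∀ᵐ t : ℝ, 0 ≤ t → h t = 0
  boundary : ∀ᵐ ω : ℝ,
    HasBoundaryValue g ω (∫ t : ℝ, h t * Complex.exp (-((ω : ℂ) * (t : ℂ) * Complex.I)))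

/-! ### The Toeplitz operator `M_g` on `L²((0,∞); X)` -/

section Toeplitz

/-- `L²((0,∞); X)`. -/
abbrev L2Half (X : Type*) [NormedAddCommGroup X] : Type _ := Lp X 2 (volume.restrict (Ioi (0 : ℝ)))

/-- `L²(ℝ; X)`. -/
abbrev L2Line (X : Type*) [NormedAddCommGroup X] : Type _ := Lp X 2 (volume : Measure ℝ)

theorem memLp_extend {Y : Type*} [NormedAddCommGroup Y] (f : L2Half Y) :
    MemLp ((Ioi (0 : ℝ)).indicator (f : ℝ → Y)) 2 volume :=
  (memLp_indicator_iff_restrict measurableSet_Ioi).2 (Lp.memLp f)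

variable (X : Type*) [NormedAddCommGroup X] [InnerProductSpace ℂ X]

/-- Extension by zero, `f ↦ f_ext`, from `L²((0,∞); X)` to `L²(ℝ; X)`. -/
def extendByZero : L2Half X →ₗᵢ[ℂ] L2Line X where
  toFun f := (memLp_extend f).toLp _
  map_add' f g := by
    rw [← MemLp.toLp_add]
    apply MemLp.toLp_congr
    have := (ae_restrict_iff' (measurableSet_Ioi (a := (0 : ℝ)))).1 (Lp.coeFn_add f g)
    filter_upwards [this] with t ht
    by_cases h : t ∈ Ioi (0 : ℝ)
    · rw [Pi.add_apply, indicator_of_mem h, indicator_of_mem h, indicator_of_mem h]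
      exact ht h
    · simp [indicator_of_notMem h]
  map_smul' c f := by
    rw [RingHom.id_apply, ← MemLp.toLp_const_smul]
    apply MemLp.toLp_congr
    have := (ae_restrict_iff' (measurableSet_Ioi (a := (0 : ℝ)))).1 (Lp.coeFn_smul c f)
    filter_upwards [this] with t ht
    by_cases h : t ∈ Ioi (0 : ℝ)
    · rw [Pi.smul_apply, indicator_of_mem h, indicator_of_mem h]
      exact ht h
    · simp [indicator_of_notMem h]
  norm_map' f := by
    change ‖(memLp_extend f).toLp _‖ = _
    rw [Lp.norm_toLp, eLpNorm_indicator_eq_eLpNorm_restrict measurableSet_Ioi, Lp.norm_def]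

variable [CompleteSpace X]

/-- The Laplace transform of `f ∈ L²((0,∞); X)`, identified with its boundary function, which is
the Fourier transform of `f_ext`.  The boundary is parametrised by `s = 2πiξ` instead of `s = iω`,
so that the Fourier transform `ξ ↦ ∫ f(t) e^{-2πiξt} dt` is unitary. -/
def laplaceL2 : L2Half X →ₗᵢ[ℂ] L2Line X :=
  (Lp.fourierTransformₗᵢ ℝ X).toLinearIsometry.comp (extendByZero X)

/-- The Hardy space `H₂(X)`, identified with the space of boundary functions: the Laplace
transforms of the functions in `L²((0,∞); X)`. -/
abbrev hardyH2 : Submodule ℂ (L2Line X) := (laplaceL2 X).range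

instance : CompleteSpace (hardyH2 X) :=
  (laplaceL2 X).isometry.isUniformInducing.isComplete_range.completeSpace_coe

variable {X}

/-- `f ↦ 𝓛⁻¹ (Π (b F))` on `L²((0,∞); X)`, where `F` is the Laplace transform of `f`, `Π` is the
orthogonal projection onto `H₂(X)` and `b ∈ L^∞` is a symbol on the boundary. -/
def toeplitz (b : Lp ℂ ∞ (volume : Measure ℝ)) (f : L2Half X) : L2Half X :=
  (laplaceL2 X).equivRange.symm
    ((hardyH2 X).orthogonalProjectionOnto (b • laplaceL2 X f : L2Line X))

end Toeplitz

/-! ### Semigroups and their generators -/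

/-- A strongly continuous semigroup of bounded operators `T(t)`, `t ≥ 0`.  The values of `toFun`
at negative times play no role. -/
structure C0Semigroup (X : Type*) [NormedAddCommGroup X] [NormedSpace ℂ X] where
  toFun : ℝ → X →L[ℂ] X
  map_zero : toFun 0 = ContinuousLinearMap.id ℂ X
  map_add : ∀ s t : ℝ, 0 ≤ s → 0 ≤ t → toFun (s + t) = (toFun s).comp (toFun t)
  strong_cont : ∀ x : X, ContinuousOn (fun t => toFun t x) (Ici 0)

namespace C0Semigroup

section Generator

variable {X : Type*} [NormedAddCommGroup X] [NormedSpace ℂ X]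

/-- `A x = y`, where `A` is the infinitesimal generator. -/
def HasGenerator (T : C0Semigroup X) (x y : X) : Prop :=
  Tendsto (fun t : ℝ => ((t⁻¹ : ℝ) : ℂ) • (T.toFun t x - x)) (𝓝[>] 0) (𝓝 y)

theorem HasGenerator.add {T : C0Semigroup X} {x y x' y' : X} (h : T.HasGenerator x y)
    (h' : T.HasGenerator x' y') : T.HasGenerator (x + x') (y + y') := by
  refine (Tendsto.add h h').congr fun t => ?_
  rw [← smul_add, _root_.map_add]
  congr 1
  abel

theorem HasGenerator.smul {T : C0Semigroup X} {x y : X} (c : ℂ) (h : T.HasGenerator x y) :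
    T.HasGenerator (c • x) (c • y) := by
  refine (Tendsto.const_smul h c).congr fun t => ?_
  rw [smul_comm, map_smul, smul_sub]

theorem HasGenerator.unique {T : C0Semigroup X} {x y y' : X} (h : T.HasGenerator x y)
    (h' : T.HasGenerator x y') : y = y' :=
  tendsto_nhds_unique h h'

/-- The infinitesimal generator `A` with its domain `D(A)`. -/
def generator (T : C0Semigroup X) : X →ₗ.[ℂ] X where
  domain :=
    { carrier := {x | ∃ y, T.HasGenerator x y}
      zero_mem' := ⟨0, by simp [HasGenerator]⟩
      add_mem' := fun ⟨y, hy⟩ ⟨y', hy'⟩ => ⟨y + y', hy.add hy'⟩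
      smul_mem' := fun c _ ⟨y, hy⟩ => ⟨c • y, hy.smul c⟩ }
  toFun :=
    { toFun := fun x => x.2.choose
      map_add' := fun x x' =>
        (x + x').2.choose_spec.unique (x.2.choose_spec.add x'.2.choose_spec)
      map_smul' := fun c x => (c • x).2.choose_spec.unique (x.2.choose_spec.smul c) }

/-- `‖T(t)‖ ≤ M e^{-ωt}` for some `M` and some `ω > 0`. -/
def ExponentiallyStable (T : C0Semigroup X) : Prop :=
  ∃ M ω : ℝ, 0 < ω ∧ ∀ t : ℝ, 0 ≤ t → ‖T.toFun t‖ ≤ M * Real.exp (-ω * t)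

theorem memLp_orbit {T : C0Semigroup X} (hT : T.ExponentiallyStable) (x : X) :
    MemLp (fun t => T.toFun t x) 2 (volume.restrict (Ioi (0 : ℝ))) := by
  obtain ⟨M, ω, hω, hM⟩ := hT
  have hmeas : AEStronglyMeasurable (fun t => T.toFun t x) (volume.restrict (Ioi (0 : ℝ))) :=
    ((T.strong_cont x).mono Ioi_subset_Ici_self).aestronglyMeasurable measurableSet_Ioi
  rw [memLp_two_iff_integrable_sq_norm hmeas]
  have hint : Integrable (fun t => (M * ‖x‖) ^ 2 * Real.exp (-(2 * ω) * t))
      (volume.restrict (Ioi (0 : ℝ))) :=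
    (exp_neg_integrableOn_Ioi 0 (by positivity)).const_mul _
  refine hint.mono' (hmeas.norm.pow 2) ?_
  filter_upwards [ae_restrict_mem measurableSet_Ioi] with t ht
  have h1 : ‖T.toFun t x‖ ≤ M * Real.exp (-ω * t) * ‖x‖ :=
    (T.toFun t).le_of_opNorm_le (hM t (le_of_lt ht)) x
  have h2 : Real.exp (-(2 * ω) * t) = Real.exp (-ω * t) ^ 2 := by
    rw [← Real.exp_nat_mul]
    congr 1
    push_cast
    ring
  rw [norm_pow, norm_norm, h2]
  calc ‖T.toFun t x‖ ^ 2 ≤ (M * Real.exp (-ω * t) * ‖x‖) ^ 2 := by gcongr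
    _ = (M * ‖x‖) ^ 2 * Real.exp (-ω * t) ^ 2 := by ring

/-- `R = (α I - A)⁻¹`, a bounded inverse of `α I - A : D(A) → X`. -/
def IsResolventAt (A : X →ₗ.[ℂ] X) (α : ℂ) (R : X →L[ℂ] X) : Prop :=
  (∀ x : X, ∃ hx : R x ∈ A.domain, α • R x - A ⟨R x, hx⟩ = x) ∧
    ∀ x : A.domain, R (α • (x : X) - A x) = x

end Generator

/-! ### The operator `g(A)` -/

section Calculus

variable {X : Type*} [NormedAddCommGroup X] [InnerProductSpace ℂ X]

/-- The orbit `T(·) x` of an exponentially stable semigroup in `L²((0,∞); X)`. -/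
def orbit {T : C0Semigroup X} (hT : T.ExponentiallyStable) (x : X) : L2Half X :=
  (memLp_orbit hT x).toLp _

variable [CompleteSpace X]

/-- `C : D(A) → X` is the operator `g(A)`: it is linear, bounded for the graph norm of `D(A)`, and
represents the output map `x ↦ M_g (T(·) x)`, i.e. `M_g (T(·) x) = C T(·) x` in `L²((0,∞); X)` for
`x ∈ D(A)`.  Here `M_g` is the Toeplitz operator whose symbol is the boundary function `b` of `g`,
in the parametrisation `b(ξ) = g(2πiξ)` of the boundary. -/
def IsFunctionOfGenerator {T : C0Semigroup X} (hT : T.ExponentiallyStable) (g : ℂ → ℂ)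
    (C : T.generator.domain →ₗ[ℂ] X) : Prop :=
  (∃ c : ℝ, ∀ x : T.generator.domain, ‖C x‖ ≤ c * (‖(x : X)‖ + ‖T.generator x‖)) ∧
    ∃ b : Lp ℂ ∞ (volume : Measure ℝ),
      (∀ᵐ ξ : ℝ, HasBoundaryValue g (2 * Real.pi * ξ) (b ξ)) ∧
      ∀ x : T.generator.domain, ∀ᵐ t ∂(volume.restrict (Ioi (0 : ℝ))),
        ∃ ht : T.toFun t x ∈ T.generator.domain, toeplitz b (orbit hT (x : X)) t = C ⟨_, ht⟩

end Calculus

end C0Semigroup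

end

/-! When the symbol is the Fourier transform of `h`, multiplication by it is convolution with `h`,
and the projection onto `H₂(X)` is restriction to the half-line. Thus `M_g f` is the restriction of
`h ⋆ f_ext` (`toeplitz_ae_eq_convolution`). For an orbit, the support of `h` in the negative
half-line turns the convolution at time `τ > 0` into `∫ h(-t) T(τ+t)x dt = T(τ) G x`, with `G` the
Hille–Phillips operator (`convolution_orbit`). Since `G` commutes with the semigroup, this is `G
T(τ)x`, so `G` restricted to `D(A)` is a `g(A)`.

Uniqueness holds because the identity fixes an operator at `T(t)x` for almost every `t`, and `T(t)x
→ x` in the graph norm as `t → 0+` (`eq_zero_of_ae_orbit`).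

For `1/(α-s)`, `G` is the Laplace transform of the semigroup at `α`, which inverts `α I - A`. -/

open scoped FourierTransform InnerProductSpace Convolution

/-! ### Fourier transform on `L¹ ∩ L²` -/

section Fourier

open scoped ContDiff

variable {E F : Type*} [NormedAddCommGroup E] [MeasurableSpace E] [BorelSpace E]
  [InnerProductSpace ℝ E] [FiniteDimensional ℝ E]
  [NormedAddCommGroup F] [InnerProductSpace ℂ F] [CompleteSpace F]

/-- On `L¹ ∩ L²` the Fourier transform on `L²` is given by the Fourier integral. -/
theorem MeasureTheory.MemLp.fourierTransform_toLp_ae_eq {f : E → F} (hf : Integrable f)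
    (hf2 : MemLp f 2) : (Lp.fourierTransformₗᵢ E F (hf2.toLp f) : E → F) =ᵐ[volume] 𝓕 f := by
  apply ae_eq_of_integral_contDiff_smul_eq
  · exact (Lp.memLp _).locallyIntegrable one_le_two
  · have hc : Continuous (𝓕 f) := VectorFourier.fourierIntegral_continuous
      Real.continuous_fourierChar (by exact continuous_inner) hf
    exact hc.locallyIntegrable
  · intro φ hφ hφc
    have h₁ : HasCompactSupport (Complex.ofRealCLM ∘ φ) := hφc.comp_left rfl
    have h₂ : ContDiff ℝ ∞ (Complex.ofRealCLM ∘ φ) := by fun_prop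
    set ψ := h₁.toSchwartzMap h₂ with hψ
    have hψφ : ∀ x, ψ x = (φ x : ℂ) := fun x => by simp [hψ]
    -- The `L²` transform agrees with the distributional one, which moves the transform onto the
    -- test function; `key2` moves it back by the multiplication formula for `L¹` functions.
    have key : ∫ x, ψ x • (Lp.fourierTransformₗᵢ E F (hf2.toLp f) : E → F) x
        = ∫ x, (𝓕 ψ) x • (hf2.toLp f : E → F) x := by
      have h := congrArg (fun D => D ψ) (Lp.fourier_toTemperedDistribution_eq (hf2.toLp f))
      simp only [TemperedDistribution.fourier_apply, Lp.toTemperedDistribution_apply] at h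
      exact h.symm
    have key2 : ∫ x, (𝓕 ψ) x • f x = ∫ x, ψ x • 𝓕 f x := by
      rw [SchwartzMap.fourier_coe]
      have := VectorFourier.integral_fourierIntegral_smul_eq_flip (μ := (volume : Measure E))
        (ν := (volume : Measure E)) (L := innerₗ E)
        Real.continuous_fourierChar continuous_inner ψ.integrable hf
      rw [flip_innerₗ] at this
      exact this
    calc ∫ x, φ x • (Lp.fourierTransformₗᵢ E F (hf2.toLp f) : E → F) x
        = ∫ x, ψ x • (Lp.fourierTransformₗᵢ E F (hf2.toLp f) : E → F) x := by
          simp [hψφ]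
      _ = ∫ x, (𝓕 ψ) x • (hf2.toLp f : E → F) x := key
      _ = ∫ x, (𝓕 ψ) x • f x := by
          refine integral_congr_ae ?_
          filter_upwards [hf2.coeFn_toLp] with x hx
          rw [hx]
      _ = ∫ x, φ x • 𝓕 f x := by rw [key2]; simp [hψφ]

end Fourier

/-! ### Toeplitz operators as truncated convolutions -/

section ToeplitzOperator

variable {X : Type*} [NormedAddCommGroup X] [InnerProductSpace ℂ X]

theorem coeFn_extendByZero (f : L2Half X) :
    (extendByZero X f : ℝ → X) =ᵐ[volume] (Ioi (0 : ℝ)).indicator (f : ℝ → X) :=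
  (memLp_extend f).coeFn_toLp

theorem extendByZero_toLp {f : ℝ → X} (hf : MemLp f 2 (volume.restrict (Ioi (0 : ℝ))))
    (hf' : MemLp ((Ioi (0 : ℝ)).indicator f) 2) : extendByZero X (hf.toLp f) = hf'.toLp _ := by
  exact MemLp.toLp_congr (memLp_extend _) hf' (ae_eq_restrict_iff_indicator_ae_eq measurableSet_Ioi |>.1 hf.coeFn_toLp)

variable [CompleteSpace X]

/-- If the product of the symbol with the Laplace transform of `f` is the Fourier transform of `u`,
then `toeplitz b f` is the restriction of `u` to the half-line. -/
theorem toeplitz_ae_eq {b : Lp ℂ ∞ (volume : Measure ℝ)} {f : L2Half X} {u : L2Line X}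
    (h : (b • laplaceL2 X f : L2Line X) = Lp.fourierTransformₗᵢ ℝ X u) :
    (toeplitz b f : ℝ → X) =ᵐ[volume.restrict (Ioi (0 : ℝ))] u := by
  have hu : MemLp (u : ℝ → X) 2 (volume.restrict (Ioi (0 : ℝ))) := (Lp.memLp u).restrict _
  set v : L2Half X := hu.toLp _ with hv
  have hproj : (hardyH2 X).orthogonalProjectionOnto (b • laplaceL2 X f : L2Line X)
      = (laplaceL2 X).equivRange v := by
    apply Subtype.ext
    change _ = laplaceL2 X v
    rw [h, ← Submodule.starProjection_apply]
    -- By Plancherel, orthogonality can be checked in the time domain: `u` minus its truncation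
    -- vanishes on the half-line, elements of the range vanish off it.
    apply Submodule.eq_starProjection_of_mem_of_inner_eq_zero
    · exact ⟨v, rfl⟩
    · rintro _ ⟨w, rfl⟩
      change ⟪Lp.fourierTransformₗᵢ ℝ X u - Lp.fourierTransformₗᵢ ℝ X (extendByZero X v),
        Lp.fourierTransformₗᵢ ℝ X (extendByZero X w)⟫_ℂ = 0
      rw [← map_sub, LinearIsometryEquiv.inner_map_map, L2.inner_def]
      refine integral_eq_zero_of_ae ?_
      have h1 : (extendByZero X v : ℝ → X) =ᵐ[volume] (Ioi (0 : ℝ)).indicator (u : ℝ → X) :=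
        (coeFn_extendByZero v).trans (ae_eq_restrict_iff_indicator_ae_eq measurableSet_Ioi |>.1 hu.coeFn_toLp)
      filter_upwards [Lp.coeFn_sub u (extendByZero X v), h1, coeFn_extendByZero w]
        with t ht ht1 ht2
      rw [ht, Pi.sub_apply, ht1, ht2]
      by_cases htI : t ∈ Ioi (0 : ℝ)
      · simp [indicator_of_mem htI]
      · simp [indicator_of_notMem htI]
  have : toeplitz b f = v := by
    rw [toeplitz, hproj, LinearIsometryEquiv.symm_apply_apply]
  rw [this]
  exact hu.coeFn_toLp

/-- The Toeplitz operator whose symbol is the Fourier transform of `h ∈ L¹`, on a bounded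
integrable function, is the truncated convolution with `h`. -/
theorem toeplitz_ae_eq_convolution {b : Lp ℂ ∞ (volume : Measure ℝ)} {h : ℝ → ℂ}
    (hh : Integrable h) (hb : (b : ℝ → ℂ) =ᵐ[volume] 𝓕 h) {f : ℝ → X} {c : ℝ}
    (hf : MemLp f 2 (volume.restrict (Ioi (0 : ℝ)))) (hf1 : IntegrableOn f (Ioi (0 : ℝ)))
    (hc : ∀ t > 0, ‖f t‖ ≤ c) :
    (toeplitz b (hf.toLp f) : ℝ → X) =ᵐ[volume.restrict (Ioi (0 : ℝ))]
      (h ⋆[ContinuousLinearMap.lsmul ℂ ℂ] (Ioi (0 : ℝ)).indicator f) := by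
  set f₀ := (Ioi (0 : ℝ)).indicator f with hf₀
  have hf₀1 : Integrable f₀ := (integrable_indicator_iff measurableSet_Ioi).2 hf1
  have hf₀2 : MemLp f₀ 2 := (memLp_indicator_iff_restrict measurableSet_Ioi).2 hf
  have hc0 : 0 ≤ c := (norm_nonneg _).trans (hc 1 one_pos)
  have hf₀c : ∀ t, ‖f₀ t‖ ≤ c := fun t => by
    by_cases ht : t ∈ Ioi (0 : ℝ)
    · rw [hf₀, indicator_of_mem ht]; exact hc t ht
    · rw [hf₀, indicator_of_notMem ht, norm_zero]; exact hc0
  set u := h ⋆[ContinuousLinearMap.lsmul ℂ ℂ] f₀ with hu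
  have hu1 : Integrable u := hh.integrable_convolution _ hf₀1
  have hub : ∀ t, ‖u t‖ ≤ ∫ s, ‖h s‖ * c := fun t => by
    refine norm_integral_le_of_norm_le (hh.norm.mul_const c) (ae_of_all _ fun s => ?_)
    rw [ContinuousLinearMap.lsmul_apply, norm_smul]
    exact mul_le_mul_of_nonneg_left (hf₀c _) (norm_nonneg _)
  -- A bounded integrable function is square integrable: `‖u‖² ≤ sup ‖u‖ · ‖u‖`.
  have hu2 : MemLp u 2 := by
    rw [memLp_two_iff_integrable_sq_norm hu1.aestronglyMeasurable]
    refine (hu1.norm.mul_const (∫ s, ‖h s‖ * c)).mono'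
      (hu1.aestronglyMeasurable.norm.pow 2) (ae_of_all _ fun t => ?_)
    rw [norm_pow, norm_norm, pow_two]
    exact mul_le_mul_of_nonneg_left (hub t) (norm_nonneg _)
  refine (toeplitz_ae_eq (u := hu2.toLp u) ?_).trans (ae_restrict_of_ae hu2.coeFn_toLp)
  apply Lp.ext
  have h1 : (laplaceL2 X (hf.toLp f) : ℝ → X) =ᵐ[volume] 𝓕 f₀ := by
    change (Lp.fourierTransformₗᵢ ℝ X (extendByZero X (hf.toLp f)) : ℝ → X) =ᵐ[volume] 𝓕 f₀
    rw [extendByZero_toLp hf hf₀2]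
    exact hf₀2.fourierTransform_toLp_ae_eq hf₀1
  filter_upwards [Lp.coeFn_lpSMul (r := 2) b (laplaceL2 X (hf.toLp f)), h1, hb,
    hu2.fourierTransform_toLp_ae_eq hu1] with ξ e1 e2 e3 e4
  rw [e1, e4, Pi.smul_apply', e2, e3, hu, Real.fourier_smul_convolution_eq hh hf₀1]

end ToeplitzOperator

/-! ### Semigroups, the Hille–Phillips operator and the resolvent -/

namespace C0Semigroup

section Semigroup

variable {X : Type*} [NormedAddCommGroup X] [NormedSpace ℂ X] {T : C0Semigroup X}

theorem HasGenerator.mem_domain {x y : X} (h : T.HasGenerator x y) : x ∈ T.generator.domain :=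
  ⟨y, h⟩

theorem hasGenerator_generator (x : T.generator.domain) :
    T.HasGenerator (x : X) (T.generator x) :=
  x.2.choose_spec

theorem HasGenerator.generator_eq {x y : X} (h : T.HasGenerator x y)
    (hx : x ∈ T.generator.domain) : T.generator ⟨x, hx⟩ = y :=
  (hasGenerator_generator ⟨x, hx⟩).unique h

/-- A bounded operator that commutes with the semigroup commutes with the generator. -/
theorem HasGenerator.map {x y : X} (h : T.HasGenerator x y) (S : X →L[ℂ] X)
    (hS : ∀ t, 0 ≤ t → ∀ z, T.toFun t (S z) = S (T.toFun t z)) : T.HasGenerator (S x) (S y) := by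
  refine ((S.continuous.tendsto y).comp h).congr' ?_
  filter_upwards [self_mem_nhdsWithin] with t ht
  rw [Function.comp_apply, map_smul, map_sub, hS t (le_of_lt ht)]

theorem toFun_comm {s t : ℝ} (hs : 0 ≤ s) (ht : 0 ≤ t) (x : X) :
    T.toFun s (T.toFun t x) = T.toFun t (T.toFun s x) := by
  rw [← ContinuousLinearMap.comp_apply, ← ContinuousLinearMap.comp_apply, ← T.map_add s t hs ht,
    ← T.map_add t s ht hs, add_comm]

theorem HasGenerator.toFun {x y : X} (h : T.HasGenerator x y) {t : ℝ} (ht : 0 ≤ t) :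
    T.HasGenerator (T.toFun t x) (T.toFun t y) :=
  h.map _ fun _ hs z => toFun_comm hs ht z

theorem toFun_mem_domain {t : ℝ} (ht : 0 ≤ t) (x : T.generator.domain) :
    T.toFun t x ∈ T.generator.domain :=
  ((hasGenerator_generator x).toFun ht).mem_domain

theorem tendsto_toFun_zero (x : X) : Tendsto (fun t => T.toFun t x) (𝓝[>] 0) (𝓝 x) := by
  have h := (T.strong_cont x 0 self_mem_Ici).mono_left (nhdsWithin_mono 0 Ioi_subset_Ici_self)
  simpa [T.map_zero] using h

theorem _root_.MeasureTheory.frequently_nhdsGT_of_ae {p : ℝ → Prop}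
    (h : ∀ᵐ t ∂(volume.restrict (Ioi (0 : ℝ))), p t) : ∃ᶠ t in 𝓝[>] (0 : ℝ), p t := by
  rw [(nhdsGT_basis (0 : ℝ)).frequently_iff]
  intro ε hε
  have hne : (ae (volume.restrict (Ioo 0 ε))).NeBot := by
    rw [ae_neBot, Ne, Measure.restrict_eq_zero]
    simpa using hε
  have h1 : ∀ᵐ t ∂(volume.restrict (Ioo 0 ε)), p t :=
    ae_mono (Measure.restrict_mono Ioo_subset_Ioi_self le_rfl) h
  exact ((ae_restrict_mem measurableSet_Ioo).and h1).exists

/-- An operator that is bounded for the graph norm of `D(A)` is determined by its values along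
almost all of each orbit. -/
theorem eq_zero_of_ae_orbit {E : T.generator.domain →ₗ[ℂ] X} {c : ℝ}
    (hc : ∀ x : T.generator.domain, ‖E x‖ ≤ c * (‖(x : X)‖ + ‖T.generator x‖))
    (hE : ∀ x : T.generator.domain, ∀ᵐ t ∂(volume.restrict (Ioi (0 : ℝ))),
      ∃ ht : T.toFun t x ∈ T.generator.domain, E ⟨_, ht⟩ = 0) : E = 0 := by
  ext x
  rw [LinearMap.zero_apply, ← norm_le_zero_iff]
  have hlim : Tendsto (fun t => c * (‖T.toFun t (x : X) - x‖
      + ‖T.toFun t (T.generator x) - T.generator x‖)) (𝓝[>] 0) (𝓝 0) := by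
    have h1 := ((tendsto_toFun_zero (T := T) (x : X)).sub_const (x : X)).norm
    have h2 := ((tendsto_toFun_zero (T := T) (T.generator x)).sub_const (T.generator x)).norm
    simpa using (h1.add h2).const_mul c
  refine ge_of_tendsto_of_frequently hlim ?_
  refine ((frequently_nhdsGT_of_ae (hE x)).and_eventually self_mem_nhdsWithin).mono ?_
  rintro t ⟨⟨ht, hEt⟩, ht0⟩
  -- As `E` vanishes at `T(t)x`, the graph-norm bound at `T(t)x - x` is a bound for `‖E x‖`; `A
  -- T(t)x = T(t) A x` makes it tend to zero.
  have h1 := hc (⟨T.toFun t x, ht⟩ - x)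
  rw [map_sub, hEt, zero_sub, norm_neg, LinearPMap.map_sub,
    ((hasGenerator_generator x).toFun (le_of_lt ht0)).generator_eq ht] at h1
  exact h1

theorem ExponentiallyStable.exists_bound (hT : T.ExponentiallyStable) :
    ∃ M : ℝ, 0 ≤ M ∧ ∀ t, 0 ≤ t → ‖T.toFun t‖ ≤ M := by
  obtain ⟨M, ω, hω, hM⟩ := hT
  have hM0 : 0 ≤ M := by simpa using (norm_nonneg _).trans (hM 0 le_rfl)
  refine ⟨M, hM0, fun t ht => (hM t ht).trans (mul_le_of_le_one_right hM0 ?_)⟩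
  rw [Real.exp_le_one_iff]
  nlinarith

theorem aestronglyMeasurable_toFun (x : X) :
    AEStronglyMeasurable (fun t => T.toFun t x) (volume.restrict (Ioi (0 : ℝ))) :=
  ((T.strong_cont x).mono Ioi_subset_Ici_self).aestronglyMeasurable measurableSet_Ioi

theorem ExponentiallyStable.integrableOn_toFun (hT : T.ExponentiallyStable) (x : X) :
    IntegrableOn (fun t => T.toFun t x) (Ioi (0 : ℝ)) := by
  obtain ⟨M, ω, hω, hM⟩ := hT
  refine ((exp_neg_integrableOn_Ioi 0 hω).const_mul M |>.mul_const ‖x‖).mono'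
    (aestronglyMeasurable_toFun x) ?_
  filter_upwards [ae_restrict_mem measurableSet_Ioi] with t ht
  exact (T.toFun t).le_of_opNorm_le (hM t (le_of_lt ht)) x

theorem ExponentiallyStable.integrableOn_smul_toFun (hT : T.ExponentiallyStable) {k : ℝ → ℂ}
    (hk : IntegrableOn k (Ioi 0)) (x : X) :
    IntegrableOn (fun t => k t • T.toFun t x) (Ioi (0 : ℝ)) := by
  obtain ⟨M, -, hM⟩ := hT.exists_bound
  refine (hk.norm.mul_const (M * ‖x‖)).mono' (hk.1.smul (aestronglyMeasurable_toFun x)) ?_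
  filter_upwards [ae_restrict_mem measurableSet_Ioi] with t ht
  rw [norm_smul]
  exact mul_le_mul_of_nonneg_left ((T.toFun t).le_of_opNorm_le (hM t (le_of_lt ht)) x)
    (norm_nonneg _)

/-- The Hille–Phillips operator `x ↦ ∫₀^∞ k(t) T(t) x dt`. -/
theorem ExponentiallyStable.exists_hillePhillips (hT : T.ExponentiallyStable) {k : ℝ → ℂ}
    (hk : IntegrableOn k (Ioi 0)) :
    ∃ G : X →L[ℂ] X, ∀ x, G x = ∫ t in Ioi (0 : ℝ), k t • T.toFun t x := by
  obtain ⟨M, -, hM⟩ := hT.exists_bound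
  refine ⟨LinearMap.mkContinuous
    { toFun := fun x => ∫ t in Ioi (0 : ℝ), k t • T.toFun t x
      map_add' := fun x y => ?_
      map_smul' := fun c x => ?_ } ((∫ t in Ioi (0 : ℝ), ‖k t‖) * M) fun x => ?_, fun x => rfl⟩
  · rw [← integral_add (hT.integrableOn_smul_toFun hk x) (hT.integrableOn_smul_toFun hk y)]
    simp only [_root_.map_add, smul_add]
  · rw [RingHom.id_apply, ← integral_smul]
    exact integral_congr_ae (ae_of_all _ fun t => by simp only [map_smul, smul_comm c])
  · rw [mul_assoc, ← integral_mul_const]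
    refine norm_integral_le_of_norm_le (hk.norm.mul_const _) ?_
    filter_upwards [ae_restrict_mem measurableSet_Ioi] with t ht
    rw [norm_smul]
    exact mul_le_mul_of_nonneg_left ((T.toFun t).le_of_opNorm_le (hM t (le_of_lt ht)) x)
      (norm_nonneg _)

variable [CompleteSpace X]

theorem toFun_integral (hT : T.ExponentiallyStable) {k : ℝ → ℂ} (hk : IntegrableOn k (Ioi 0))
    {τ : ℝ} (hτ : 0 ≤ τ) (x : X) :
    T.toFun τ (∫ t in Ioi (0 : ℝ), k t • T.toFun t x)
      = ∫ t in Ioi (0 : ℝ), k t • T.toFun (τ + t) x := by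
  rw [← ContinuousLinearMap.integral_comp_comm _ (hT.integrableOn_smul_toFun hk x)]
  refine setIntegral_congr_fun measurableSet_Ioi fun t ht => ?_
  change T.toFun τ (k t • T.toFun t x) = k t • T.toFun (τ + t) x
  rw [map_smul, T.map_add τ t hτ (le_of_lt ht), ContinuousLinearMap.comp_apply]

theorem toFun_hillePhillips_comm (hT : T.ExponentiallyStable) {k : ℝ → ℂ}
    (hk : IntegrableOn k (Ioi 0)) {G : X →L[ℂ] X}
    (hG : ∀ x, G x = ∫ t in Ioi (0 : ℝ), k t • T.toFun t x) {τ : ℝ} (hτ : 0 ≤ τ) (x : X) :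
    T.toFun τ (G x) = G (T.toFun τ x) := by
  rw [hG, hG, toFun_integral hT hk hτ]
  refine setIntegral_congr_fun measurableSet_Ioi fun t ht => ?_
  rw [add_comm, T.map_add t τ (le_of_lt ht) hτ, ContinuousLinearMap.comp_apply]

/-- Only `s ≤ 0` contributes, and then `τ - s > 0`, so the cutoff of the orbit never acts;
substitute `t = -s`. -/
theorem convolution_orbit (hT : T.ExponentiallyStable) {h : ℝ → ℂ} (hh : Integrable h)
    (hs : ∀ᵐ t : ℝ, 0 ≤ t → h t = 0) {τ : ℝ} (hτ : 0 < τ) (x : X) :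
    (h ⋆[ContinuousLinearMap.lsmul ℂ ℂ] (Ioi (0 : ℝ)).indicator fun t => T.toFun t x) τ
      = T.toFun τ (∫ t in Ioi (0 : ℝ), h (-t) • T.toFun t x) := by
  rw [toFun_integral hT hh.comp_neg.integrableOn hτ.le]
  have h1 := integral_comp_neg_Ioi 0 fun s => h s • T.toFun (τ - s) x
  simp only [sub_neg_eq_add, neg_zero] at h1
  rw [h1, ← integral_indicator measurableSet_Iic, convolution_def]
  refine integral_congr_ae ?_
  filter_upwards [hs] with s hs
  rw [ContinuousLinearMap.lsmul_apply]
  by_cases h0 : s ∈ Iic (0 : ℝ)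
  · rw [indicator_of_mem h0, indicator_of_mem (show τ - s ∈ Ioi (0 : ℝ) by
      simp only [mem_Iic, mem_Ioi] at *; linarith)]
  · rw [indicator_of_notMem h0, hs (le_of_lt (not_le.1 h0)), zero_smul]

/-- The Laplace transform of the semigroup maps into the domain of the generator. -/
theorem hasGenerator_laplace (hT : T.ExponentiallyStable) {α : ℂ} (hα : 0 < α.re) {R : X →L[ℂ] X}
    (hR : ∀ x, R x = ∫ t in Ioi (0 : ℝ), Complex.exp (-α * t) • T.toFun t x) (x : X) :
    T.HasGenerator (R x) (α • R x - x) := by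
  have hk : IntegrableOn (fun t : ℝ => Complex.exp (-α * t)) (Ioi 0) :=
    integrableOn_exp_mul_complex_Ioi (by simpa using hα) 0
  -- Freezing the orbit at negative times makes `F` continuous on the whole line, so that its
  -- primitive has a two-sided derivative at `0`.
  set F : ℝ → X := fun t => Complex.exp (-α * t) • T.toFun (max t 0) x with hF
  have hFc : Continuous F := by
    have h1 : Continuous fun t : ℝ => T.toFun (max t 0) x :=
      (T.strong_cont x).comp_continuous (by fun_prop) fun t => le_max_right t 0
    fun_prop
  have hFR : R x = ∫ t in Ioi (0 : ℝ), F t := by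
    rw [hR]
    refine setIntegral_congr_fun measurableSet_Ioi fun t ht => ?_
    simp only [hF, max_eq_left (le_of_lt (mem_Ioi.1 ht))]
  have hFi : IntegrableOn F (Ioi 0) := by
    refine (hT.integrableOn_smul_toFun hk x).congr_fun (fun t ht => ?_) measurableSet_Ioi
    simp only [hF, max_eq_left (le_of_lt (mem_Ioi.1 ht))]
  -- Substituting `s = τ + t` leaves a factor `e^{ατ}` and a tail integral of `F`; the product rule
  -- at `τ = 0` then gives `α R x - x`.
  have hshift : ∀ τ, 0 ≤ τ → T.toFun τ (R x)
      = Complex.exp (α * τ) • (R x - ∫ t in (0 : ℝ)..τ, F t) := fun τ hτ => by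
    have h1 : R x - ∫ t in (0 : ℝ)..τ, F t = ∫ t in Ioi τ, F t := by
      rw [hFR, ← intervalIntegral.integral_interval_add_Ioi hFi
        (hFi.mono_set (Ioi_subset_Ioi hτ)), add_sub_cancel_left]
    rw [h1, hR, toFun_integral hT hk hτ, ← integral_smul]
    have h2 := (measurePreserving_add_left volume τ).setIntegral_preimage_emb
      (measurableEmbedding_addLeft τ) (fun s => Complex.exp (α * τ) • F s) (Ioi τ)
    rw [← h2, preimage_const_add_Ioi, sub_self]
    refine setIntegral_congr_fun measurableSet_Ioi fun t ht => ?_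
    have ht' : 0 ≤ τ + t := add_nonneg hτ (le_of_lt ht)
    simp only [hF, max_eq_left ht', smul_smul, ← Complex.exp_add]
    congr 2
    push_cast
    ring
  have hd1 : HasDerivAt (fun τ : ℝ => Complex.exp (α * τ)) α 0 := by
    simpa using ((hasDerivAt_id (0 : ℝ)).ofReal_comp.const_mul α).cexp
  have hd2 : HasDerivAt (fun τ : ℝ => R x - ∫ t in (0 : ℝ)..τ, F t) (-x) 0 := by
    have := (hFc.integral_hasStrictDerivAt 0 0).hasDerivAt.const_sub (R x)
    simpa [hF, T.map_zero] using this
  have hd := (hd1.smul hd2).tendsto_slope_zero_right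
  simp only [Complex.ofReal_zero, mul_zero, Complex.exp_zero, one_smul, zero_add,
    intervalIntegral.integral_same, sub_zero, Pi.smul_apply'] at hd
  rw [neg_add_eq_sub] at hd
  refine hd.congr' ?_
  filter_upwards [self_mem_nhdsWithin] with τ hτ
  rw [hshift τ (le_of_lt hτ), Complex.coe_smul]

theorem isResolventAt_laplace (hT : T.ExponentiallyStable) {α : ℂ} (hα : 0 < α.re)
    {R : X →L[ℂ] X}
    (hR : ∀ x, R x = ∫ t in Ioi (0 : ℝ), Complex.exp (-α * t) • T.toFun t x) :
    IsResolventAt T.generator α R := by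
  have hk : IntegrableOn (fun t : ℝ => Complex.exp (-α * t)) (Ioi 0) :=
    integrableOn_exp_mul_complex_Ioi (by simpa using hα) 0
  refine ⟨fun x => ⟨(hasGenerator_laplace hT hα hR x).mem_domain, ?_⟩, fun x => ?_⟩
  · rw [(hasGenerator_laplace hT hα hR x).generator_eq, sub_sub_cancel]
  -- `R` commutes with the semigroup, so `A R x = R A x`; compare with `A R x = α R x - x`.
  · have h1 := (hasGenerator_generator x).map R fun t ht z =>
      toFun_hillePhillips_comm hT hk hR ht z
    rw [map_sub, map_smul, h1.unique (hasGenerator_laplace hT hα hR x), sub_sub_cancel]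

end Semigroup

/-! ### Identification of `g(A)` -/

section FunctionalCalculus

variable {X : Type*} [NormedAddCommGroup X] [InnerProductSpace ℂ X] [CompleteSpace X]
  {T : C0Semigroup X}

theorem _root_.IsFourierTransformOfL1.ae_hasBoundaryValue {g : ℂ → ℂ} {h : ℝ → ℂ}
    (H : IsFourierTransformOfL1 g h) :
    ∀ᵐ ξ : ℝ, HasBoundaryValue g (2 * Real.pi * ξ) (𝓕 h ξ) := by
  -- The rescaling `ω = 2πξ` preserves null sets.
  have hq := Measure.quasiMeasurePreserving_smul (volume : Measure ℝ)
    (r := 2 * Real.pi) Real.two_pi_pos.ne'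
  filter_upwards [hq.ae H.boundary] with ξ hξ
  rw [smul_eq_mul] at hξ
  convert hξ using 1
  rw [Real.fourier_real_eq_integral_exp_smul]
  congr 1 with t
  rw [smul_eq_mul, mul_comm]
  congr 2
  push_cast
  ring

theorem isFunctionOfGenerator_iff (hT : T.ExponentiallyStable) {g : ℂ → ℂ} {h : ℝ → ℂ}
    (H : IsFourierTransformOfL1 g h) {G : X →L[ℂ] X}
    (hG : ∀ x, G x = ∫ t in Ioi (0 : ℝ), h (-t) • T.toFun t x)
    (C : T.generator.domain →ₗ[ℂ] X) :
    IsFunctionOfGenerator hT g C ↔ C = (G : X →ₗ[ℂ] X).domRestrict T.generator.domain := by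
  have hk : IntegrableOn (fun t => h (-t)) (Ioi 0) := H.integrable.comp_neg.integrableOn
  have htoep : ∀ b : Lp ℂ ∞ (volume : Measure ℝ), (b : ℝ → ℂ) =ᵐ[volume] 𝓕 h → ∀ x : X,
      ∀ᵐ t ∂(volume.restrict (Ioi (0 : ℝ))), toeplitz b (orbit hT x) t = G (T.toFun t x) := by
    intro b hb x
    obtain ⟨M, -, hM⟩ := hT.exists_bound
    have h1 := toeplitz_ae_eq_convolution H.integrable hb (memLp_orbit hT x)
      (hT.integrableOn_toFun x) (c := M * ‖x‖)
      fun t ht => (T.toFun t).le_of_opNorm_le (hM t (le_of_lt ht)) x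
    filter_upwards [h1, ae_restrict_mem measurableSet_Ioi] with t e ht
    rw [← toFun_hillePhillips_comm hT hk hG (le_of_lt ht), hG,
      ← convolution_orbit hT H.integrable H.support ht]
    exact e
  constructor
  · rintro ⟨⟨c, hc⟩, b, hb, hC⟩
    -- Boundary limits are unique, so every admissible symbol is the Fourier transform of `h`.
    have hb' : (b : ℝ → ℂ) =ᵐ[volume] 𝓕 h := by
      filter_upwards [hb, H.ae_hasBoundaryValue] with ξ h1 h2
      exact tendsto_nhds_unique h1 h2
    rw [← sub_eq_zero]
    refine eq_zero_of_ae_orbit (c := c + ‖G‖) (fun x => ?_) fun x => ?_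
    · refine (norm_sub_le _ _).trans ?_
      rw [add_mul]
      refine add_le_add (hc x) ((G.le_opNorm x).trans ?_)
      exact mul_le_mul_of_nonneg_left (le_add_of_nonneg_right (norm_nonneg _)) (norm_nonneg _)
    · filter_upwards [hC x, htoep b hb' x] with t ⟨ht, h1⟩ h2
      exact ⟨ht, sub_eq_zero.2 (h1.symm.trans h2)⟩
  · rintro rfl
    refine ⟨⟨‖G‖, fun x => (G.le_opNorm x).trans ?_⟩, ?_⟩
    · exact mul_le_mul_of_nonneg_left (le_add_of_nonneg_right (norm_nonneg _)) (norm_nonneg _)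
    · have hc : Continuous (𝓕 h) := VectorFourier.fourierIntegral_continuous
        Real.continuous_fourierChar (by exact continuous_inner) H.integrable
      have hm : MemLp (𝓕 h) ∞ := memLp_top_of_bound hc.aestronglyMeasurable _
        (ae_of_all _ fun ξ => VectorFourier.norm_fourierIntegral_le_integral_norm _ _ _ h ξ)
      refine ⟨hm.toLp _, ?_, fun x => ?_⟩
      · filter_upwards [H.ae_hasBoundaryValue, hm.coeFn_toLp] with ξ h1 h2
        rwa [h2]
      · filter_upwards [htoep _ hm.coeFn_toLp x, ae_restrict_mem measurableSet_Ioi] with t h1 ht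
        exact ⟨toFun_mem_domain (le_of_lt ht) x, h1⟩

end FunctionalCalculus

end C0Semigroup

/-! ### The symbol `1/(α - s)` -/

section ResolventSymbol

variable {α : ℂ}

theorem re_le_norm_sub_of_re_nonpos {s : ℂ} (hs : s.re ≤ 0) : α.re ≤ ‖α - s‖ := by
  refine le_trans ?_ (Complex.re_le_norm _)
  rw [Complex.sub_re]
  linarith

theorem sub_ne_zero_of_re_pos (hα : 0 < α.re) {s : ℂ} (hs : s.re ≤ 0) : α - s ≠ 0 :=
  norm_pos_iff.1 (hα.trans_le (re_le_norm_sub_of_re_nonpos hs))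

theorem memHInfMinus_resolvent (hα : 0 < α.re) : MemHInfMinus fun s => 1 / (α - s) := by
  refine ⟨fun s hs => ?_, α.re⁻¹, fun s hs => ?_⟩
  · have := sub_ne_zero_of_re_pos hα (le_of_lt hs)
    exact DifferentiableAt.differentiableWithinAt (by fun_prop (disch := assumption))
  · rw [norm_div, norm_one, one_div]
    exact inv_anti₀ hα (re_le_norm_sub_of_re_nonpos hs.le)

theorem isFourierTransformOfL1_resolvent (hα : 0 < α.re) :
    IsFourierTransformOfL1 (fun s => 1 / (α - s))
      ((Iio (0 : ℝ)).indicator fun t => Complex.exp (α * t)) where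
  integrable := (integrable_indicator_iff measurableSet_Iio).2
    ((integrableOn_exp_mul_complex_Iic hα 0).mono_set Iio_subset_Iic_self)
  support := ae_of_all _ fun t ht => indicator_of_notMem (notMem_Iio.2 ht) _
  boundary := ae_of_all _ fun ω => by
    have hre : 0 < (α - ω * Complex.I).re := by simpa using hα
    have hint : ∫ t : ℝ, (Iio (0 : ℝ)).indicator (fun t : ℝ => Complex.exp (α * t)) t
        * Complex.exp (-((ω : ℂ) * (t : ℂ) * Complex.I)) = 1 / (α - ω * Complex.I) := by
      have h1 := integral_exp_mul_complex_Iic hre 0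
      rw [Complex.ofReal_zero, mul_zero, Complex.exp_zero, integral_Iic_eq_integral_Iio,
        ← integral_indicator measurableSet_Iio] at h1
      rw [← h1]
      congr 1 with t
      by_cases ht : t ∈ Iio (0 : ℝ)
      · rw [indicator_of_mem ht, indicator_of_mem ht, ← Complex.exp_add]
        congr 1
        ring
      · rw [indicator_of_notMem ht, indicator_of_notMem ht, zero_mul]
    rw [hint]
    have hne : α - ((0 : ℝ) + (ω : ℂ) * Complex.I) ≠ 0 :=
      sub_ne_zero_of_re_pos hα (by simp)
    have hc : ContinuousAt (fun r : ℝ => 1 / (α - ((r : ℂ) + (ω : ℂ) * Complex.I))) 0 := by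
      fun_prop (disch := assumption)
    have := hc.tendsto.mono_left (nhdsWithin_le_nhds (s := Iio 0))
    simpa [HasBoundaryValue] using this

end ResolventSymbol

theorem lemmaL3p1 {X : Type*} [NormedAddCommGroup X] [InnerProductSpace ℂ X] [CompleteSpace X]
    [TopologicalSpace.SeparableSpace X] (T : C0Semigroup X) (hT : T.ExponentiallyStable) :
    (∀ (g : ℂ → ℂ) (h : ℝ → ℂ), MemHInfMinus g → IsFourierTransformOfL1 g h →
      ∃ G : X →L[ℂ] X,
        (∀ C : T.generator.domain →ₗ[ℂ] X,
          C0Semigroup.IsFunctionOfGenerator hT g C ↔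
            C = (G : X →ₗ[ℂ] X).domRestrict T.generator.domain) ∧
        ∀ x : X, IntegrableOn (fun t : ℝ => h (-t) • T.toFun t x) (Ioi 0) ∧
          G x = ∫ t in Ioi (0 : ℝ), h (-t) • T.toFun t x) ∧
    (∀ α : ℂ, 0 < α.re →
      MemHInfMinus (fun s => 1 / (α - s)) ∧
      IsFourierTransformOfL1 (fun s => 1 / (α - s))
        ((Iio (0 : ℝ)).indicator fun t => Complex.exp (α * t)) ∧
      ∃ R : X →L[ℂ] X, C0Semigroup.IsResolventAt T.generator α R ∧
        ∀ C : T.generator.domain →ₗ[ℂ] X,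
          C0Semigroup.IsFunctionOfGenerator hT (fun s => 1 / (α - s)) C ↔
            C = (R : X →ₗ[ℂ] X).domRestrict T.generator.domain) := by
  constructor
  · intro g h _ H
    have hk : IntegrableOn (fun t => h (-t)) (Ioi 0) := H.integrable.comp_neg.integrableOn
    obtain ⟨G, hG⟩ := hT.exists_hillePhillips hk
    exact ⟨G, C0Semigroup.isFunctionOfGenerator_iff hT H hG,
      fun x => ⟨hT.integrableOn_smul_toFun hk x, hG x⟩⟩
  · intro α hα
    have H := isFourierTransformOfL1_resolvent hα
    refine ⟨memHInfMinus_resolvent hα, H, ?_⟩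
    obtain ⟨R, hR⟩ := hT.exists_hillePhillips H.integrable.comp_neg.integrableOn
    refine ⟨R, C0Semigroup.isResolventAt_laplace hT hα fun x => ?_,
      C0Semigroup.isFunctionOfGenerator_iff hT H hR⟩
    rw [hR]
    refine setIntegral_congr_fun measurableSet_Ioi fun t ht => ?_
    rw [indicator_of_mem (mem_Iio.2 (neg_lt_zero.2 (mem_Ioi.1 ht)))]
    simp
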